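/- Let $d\ge 1$, $\lambda_1,\dots,\lambda_d>0$ and $\alpha_1,\dots,\alpha_d\in(0,1)$. Let $\{N(\mathbf t),\ \mathbf t\in\mathbb R_+^d\}$ be a multiparameter Poisson process (MPP) with transition parameter $(\lambda_1,\dots,\lambda_d)$, that is, a random field with values in $\{0,1,2,\dots\}$ which almost surely is null at $\mathbf 0$ and non-decreasing for the componentwise order, has independent increments along chains $\mathbf 0=\mathbf t^{(0)}\prec\mathbf t^{(1)}\prec\dots\prec\mathbf t^{(m)}$ (where $\mathbf s\prec\mathbf t$ means $s_i<t_i$ for all $i$) and stationary increments ($N(\mathbf t)-N(\mathbf s)\overset{d}{=}N(\mathbf t-\mathbf s)$ whenever $s_i\le t_i$ for all $i$), and is such that $N(\mathbf t)$ has the Poisson distribution with mean $\lambda_1t_1+\dots+\lambda_dt_d$ for every $\mathbf t\in\mathbb R_+^d$. Let $S_1,\dots,S_d$ be independent stable subordinators with indices $\alpha_1,\dots,\alpha_d$, that is, $S_i=\{S_i(t),\ t\ge0\}$ is a non-decreasing $\mathbb R_+$-valued Lévy process with $\mathbb E e^{-wS_i(t)}=e^{-tw^{\alpha_i}}$ for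 $w>0$, $t\ge 0$, and suppose that $(S_1,\dots,S_d)$ is independent of the MPP. For $t\ge 0$ and $n\ge 0$ put $$p(n,t)=\Pr\{N(S_1(t),\dots,S_d(t))=n\}.$$ Then $N(S_1(t),\dots,S_d(t))$ is a random variable (almost everywhere measurable) for every $t\ge0$, and the following hold, with the convention $1/\Gamma(-k)=0$ for $k=0,1,2,\dots$. (a) For all $n\ge0$ and $t\ge0$, $$p(n,t)=\sum_{\substack{n_1,\dots,n_d\ge 0\\ n_1+\dots+n_d=n}}\ \prod_{i=1}^{d}\frac{(-1)^{n_i}}{n_i!}\sum_{r=0}^{\infty}\frac{(-\lambda_i^{\alpha_i}t)^r\,\Gamma(\alpha_ir+1)}{r!\,\Gamma(\alpha_ir+1-n_i)},$$ and all these series converge absolutely. (b) For all $n\ge0$ and $t\ge0$ (with the one-sided derivative at $t=0$), $$\frac{\mathrm d}{\mathrm dt}p(n,t)=-\sum_{j=1}^{d}\lambda_j^{\alpha_j}\sum_{r=0}^{n}\frac{(-1)^{r}\,\Gamma(\alpha_j+1)}{r!\,\Gamma(\alpha_j+1-r)}\,p(n-r,t)=-\sum_{j=1}^{d}\lambda_j^{\alpha_j}(I-B)^{\alpha_j}p(n,t),$$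 where $Bp(n,t)=p(n-1,t)$, $p(n,t)=0$ for $n<0$ and $(I-B)^{\alpha}=\sum_{r\ge0}(-1)^r\binom{\alpha}{r}B^r$. (c) $p(0,0)=1$ and $p(n,0)=0$ for all $n\ge1$. -/

import Mathlib

open MeasureTheory ProbabilityTheory Filter Topology
open scoped NNReal

noncomputable section

namespace MPP

variable {Ω : Type*} [MeasurableSpace Ω]

/-- A `d`-parameter counting process: a random field on `ℝ₊ᵈ` with values in the non-negative
integers, null at the origin and non-decreasing for the componentwise order. -/
structure IsCountingProcess {d : ℕ} (N : (Fin d → ℝ≥0) → Ω → ℕ) (P : Measure Ω) : Prop where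
  measurable : ∀ t, Measurable (N t)
  zero : ∀ᵐ ω ∂P, N 0 ω = 0
  mono : ∀ᵐ ω ∂P, ∀ s t, s ≤ t → N s ω ≤ N t ω

/-- A multiparameter Poisson process (MPP) with transition parameter `lam`.
Increments are taken in `ℝ`, so that the subtraction is the genuine one. -/
structure IsMPP {d : ℕ} (lam : Fin d → ℝ) (N : (Fin d → ℝ≥0) → Ω → ℕ) (P : Measure Ω) : Prop
    extends IsCountingProcess N P where
  /-- independent increments along chains `0 = τ₀ ≺ τ₁ ≺ ⋯ ≺ τₘ`, where `s ≺ t` means that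
  `s i < t i` for all `i` -/
  indep_increments : ∀ (m : ℕ) (τ : Fin (m + 1) → Fin d → ℝ≥0), τ 0 = 0 →
    (∀ (k : Fin m) (i : Fin d), τ k.castSucc i < τ k.succ i) →
    iIndepFun (fun (k : Fin m) ω => (N (τ k.succ) ω : ℝ) - (N (τ k.castSucc) ω : ℝ)) P
  stationary : ∀ s t : Fin d → ℝ≥0, s ≤ t →
    IdentDistrib (fun ω => (N t ω : ℝ) - (N s ω : ℝ)) (fun ω => (N (t - s) ω : ℝ)) P P
  /-- `N t` has the Poisson distribution with mean `∑ i, lam i * t i` -/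
  poisson : ∀ (t : Fin d → ℝ≥0) (n : ℕ),
    P.real {ω | N t ω = n} =
      (∑ i, lam i * t i) ^ n / (n.factorial : ℝ) * Real.exp (-∑ i, lam i * t i)

/-- A (one-parameter) subordinator: a non-decreasing Lévy process with values in `ℝ₊`. -/
structure IsSubordinator (S : ℝ≥0 → Ω → ℝ≥0) (P : Measure Ω) : Prop where
  measurable : ∀ t, Measurable (S t)
  zero : ∀ᵐ ω ∂P, S 0 ω = 0
  indep_increments : HasIndepIncrements (fun t ω => (S t ω : ℝ)) P
  stationary : ∀ s t : ℝ≥0, s ≤ t →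
    IdentDistrib (fun ω => (S t ω : ℝ) - (S s ω : ℝ)) (fun ω => (S (t - s) ω : ℝ)) P P
  /-- the paths are almost surely right-continuous with left limits -/
  cadlag : ∀ᵐ ω ∂P, ∀ t : ℝ≥0, ContinuousWithinAt (fun u => S u ω) (Set.Ici t) t ∧
    ∃ l : ℝ≥0, Tendsto (fun u => S u ω) (𝓝[<] t) (𝓝 l)
  /-- stochastic continuity -/
  stochCont : ∀ t : ℝ≥0, TendstoInMeasure P S (𝓝 t) (S t)
  mono : ∀ᵐ ω ∂P, ∀ s t : ℝ≥0, s ≤ t → S s ω ≤ S t ω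

/-- An `α`-stable subordinator: `E exp (-w S(t)) = exp (-t w ^ α)` for all `w > 0`. -/
structure IsStableSubordinator (α : ℝ) (S : ℝ≥0 → Ω → ℝ≥0) (P : Measure Ω) : Prop
    extends IsSubordinator S P where
  laplace : ∀ (t : ℝ≥0) (w : ℝ), 0 < w →
    ∫ ω, Real.exp (-w * (S t ω : ℝ)) ∂P = Real.exp (-(t : ℝ) * w ^ α)

/-- The time-changed process `N (S₁(t), …, S_d(t))`. -/
def timeChange {d : ℕ} (N : (Fin d → ℝ≥0) → Ω → ℕ) (S : Fin d → ℝ≥0 → Ω → ℝ≥0)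
    (t : ℝ≥0) (ω : Ω) : ℕ :=
  N (fun i => S i t ω) ω

/-- The `r`-th term of the series for the space-fractional Poisson probabilities. `Real.Gamma`
vanishes at its poles, hence `x / Real.Gamma x'` is `0` there, which is the usual convention
`1 / Γ = 0` at the poles. -/
def sfppTerm (α lam : ℝ) (n : ℕ) (t : ℝ) (r : ℕ) : ℝ :=
  (-(lam ^ α) * t) ^ r * Real.Gamma (α * r + 1) /
    ((r.factorial : ℝ) * Real.Gamma (α * r + 1 - n))

/-- The space-fractional Poisson probability of `n` at time `t`, as a series. -/
def sfppProb (α lam : ℝ) (n : ℕ) (t : ℝ) : ℝ :=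
  (-1) ^ n / (n.factorial : ℝ) * ∑' r : ℕ, sfppTerm α lam n t r

/-- The backward shift `(B q)(n) = q (n - 1)`, with `q (n) = 0` for `n < 0`. -/
def backShift (q : ℕ → ℝ) : ℕ → ℝ
  | 0 => 0
  | n + 1 => q n

/-- The fractional difference operator `(I - B) ^ α = ∑ r, (-1) ^ r * (α choose r) * B ^ r`. -/
def fracDiff (α : ℝ) (q : ℕ → ℝ) (n : ℕ) : ℝ :=
  ∑' r : ℕ, (-1) ^ r * Ring.choose α r * (backShift^[r] q) n

end MPP

end

namespace MPP

/-! ### Falling factorials -/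

/-! Conditionally on the subordinators the count is Poisson with mean Z = ∑ λ_i S_i(t), so p(n,t) =
E[Z^n e^{-Z}/n!]. Conditioning needs care, since N is not assumed jointly measurable: N at the
random point is squeezed between its values at the corners of a dyadic cube, and Borel–Cantelli
makes these eventually equal (`IsMPP.measureReal_comp_eq`).

The multinomial theorem and independence split this expectation into one-dimensional ones
(`integral_sum_pow_mul_exp_neg`). Each is a derivative of a stable moment generating function,
expanded by termwise differentiation (`iteratedDeriv_exp_mul_rpow`); this is (a).

Unsplit, p(n,t) is the n-th Taylor coefficient at -1 of e^{t g}, the moment generating function of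
Z, where g(x) = -∑ λ_j^{α_j} (-x)^{α_j}. These coefficients form a convolution semigroup in t whose
generator is convolution with the Taylor coefficients of g (`hasDerivAt_expTaylor`). The latter are
the coefficients of -∑ λ_j^{α_j} (I-B)^{α_j}, giving (b); (c) is the case of the constant function
1. -/

lemma Gamma_add_one_div_Gamma_sub {x : ℝ} (hx : 0 ≤ x) (n : ℕ) :
    Real.Gamma (x + 1) / Real.Gamma (x + 1 - n) = (descPochhammer ℝ n).eval x := by
  induction n with
  | zero => simp [(Real.Gamma_pos_of_pos (by positivity : 0 < x + 1)).ne']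
  | succ n ih =>
    rw [descPochhammer_succ_eval, ← ih]
    have h1 : x + 1 - ((n + 1 : ℕ) : ℝ) = x - n := by push_cast; ring
    have h2 : x + 1 - (n : ℝ) = (x - n) + 1 := by ring
    rw [h1, h2]
    -- At x = n the recursion for Γ fails, but `Real.Gamma 0 = 0` makes the quotient 0, matching the
    -- new factor x - n.
    rcases eq_or_ne (x - n) 0 with h | h
    · simp [h]
    · rw [Real.Gamma_add_one h]
      field_simp

lemma ringChoose_eq_descPochhammer_div (x : ℝ) (n : ℕ) :
    Ring.choose x n = (descPochhammer ℝ n).eval x / n.factorial := by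
  rw [Ring.choose_eq_smul, ← Polynomial.aeval_eq_smeval, Polynomial.aeval_def,
    Polynomial.eval₂_eq_eval_map, descPochhammer_map, smul_eq_mul, div_eq_inv_mul]

/-- Each factor is at most r + n in absolute value, and y^n ≤ n! e^y. The growth in r is thus only
geometric, which r! in the series absorbs. -/
lemma abs_descPochhammer_mul_le {α : ℝ} (hα : α ∈ Set.Ioo (0 : ℝ) 1) (n r : ℕ) :
    |(descPochhammer ℝ n).eval (α * r)| ≤ n.factorial * Real.exp n * Real.exp 1 ^ r := by
  have h1 : |(descPochhammer ℝ n).eval (α * r)| ≤ ((r : ℝ) + n) ^ n := by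
    rw [descPochhammer_eval_eq_prod_range, Finset.abs_prod]
    refine (Finset.prod_le_prod (g := fun _ => (r : ℝ) + n) (fun _ _ => abs_nonneg _) ?_).trans
      (by simp)
    intro j hj
    have hj' : (j : ℝ) ≤ n := by exact_mod_cast (Finset.mem_range.1 hj).le
    have h0 : 0 ≤ α * r := mul_nonneg hα.1.le (Nat.cast_nonneg r)
    have h2 : α * r ≤ r := mul_le_of_le_one_left (Nat.cast_nonneg r) hα.2.le
    have h3 : (0 : ℝ) ≤ j := Nat.cast_nonneg j
    rw [abs_le]
    constructor <;> linarith
  have h2 : ((r : ℝ) + n) ^ n ≤ n.factorial * Real.exp (r + n) := by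
    have := Real.pow_div_factorial_le_exp ((r : ℝ) + n) (by positivity) n
    rwa [div_le_iff₀' (by positivity)] at this
  calc _ ≤ n.factorial * Real.exp (r + n) := h1.trans h2
    _ = _ := by rw [Real.exp_add, ← Real.exp_nat_mul, mul_one]; ring

/-! ### Termwise differentiation of the stretched exponential -/

/-- The `r`-th term of the `n`-th derivative of `x ↦ exp (c * x ^ α)`. -/
noncomputable def expRpowTerm (α c : ℝ) (n r : ℕ) (x : ℝ) : ℝ :=
  c ^ r / r.factorial * (descPochhammer ℝ n).eval (α * r) * x ^ (α * r - n)

lemma expRpowTerm_bound {α : ℝ} (hα : α ∈ Set.Ioo (0 : ℝ) 1) (c : ℝ) (n r : ℕ) {a b x : ℝ}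
    (ha : 0 < a) (hax : a ≤ x) (hxb : x ≤ b) :
    ‖expRpowTerm α c n r x‖ ≤ (n.factorial * Real.exp n * (a ^ n)⁻¹) *
      ((|c| * Real.exp 1 * b ^ α) ^ r / r.factorial) := by
  have hx : 0 < x := ha.trans_le hax
  have h1 : x ^ (α * r - n) ≤ (b ^ α) ^ r * (a ^ n)⁻¹ := by
    rw [Real.rpow_sub hx, Real.rpow_mul hx.le, Real.rpow_natCast, Real.rpow_natCast, div_eq_mul_inv]
    have := hα.1.le
    have hb : 0 < b := hx.trans_le hxb
    gcongr
  have h2 := abs_descPochhammer_mul_le hα n r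
  rw [expRpowTerm, norm_mul, norm_mul, Real.norm_eq_abs, Real.norm_eq_abs, Real.norm_eq_abs,
    abs_div, abs_pow, Nat.abs_cast, abs_of_pos (Real.rpow_pos_of_pos hx _)]
  calc _ ≤ |c| ^ r / r.factorial * (n.factorial * Real.exp n * Real.exp 1 ^ r) *
        ((b ^ α) ^ r * (a ^ n)⁻¹) := by gcongr
    _ = _ := by rw [mul_pow, mul_pow]; ring

lemma summable_expRpowTerm {α : ℝ} (hα : α ∈ Set.Ioo (0 : ℝ) 1) (c : ℝ) (n : ℕ) {x : ℝ}
    (hx : 0 < x) : Summable (fun r => expRpowTerm α c n r x) :=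
  Summable.of_norm_bounded ((Real.summable_pow_div_factorial _).mul_left _)
    (fun r => expRpowTerm_bound hα c n r hx le_rfl le_rfl)

lemma hasDerivAt_expRpowTerm (α c : ℝ) (n r : ℕ) {x : ℝ} (hx : 0 < x) :
    HasDerivAt (expRpowTerm α c n r) (expRpowTerm α c (n + 1) r x) x := by
  have h := (Real.hasDerivAt_rpow_const (p := α * r - n) (Or.inl hx.ne')).const_mul
    (c ^ r / r.factorial * (descPochhammer ℝ n).eval (α * r))
  refine h.congr_deriv ?_
  rw [expRpowTerm, descPochhammer_succ_eval, Nat.cast_succ, ← sub_sub]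
  ring

lemma iteratedDeriv_exp_mul_rpow {α : ℝ} (hα : α ∈ Set.Ioo (0 : ℝ) 1) (c : ℝ) (n : ℕ) :
    ∀ {x : ℝ}, 0 < x → iteratedDeriv n (fun y => Real.exp (c * y ^ α)) x =
      ∑' r, expRpowTerm α c n r x := by
  induction n with
  | zero =>
    intro x hx
    rw [iteratedDeriv_zero, Real.exp_eq_exp_ℝ, NormedSpace.exp_eq_tsum_div]
    refine tsum_congr fun r => ?_
    simp only [expRpowTerm, descPochhammer_zero, Polynomial.eval_one, Nat.cast_zero, sub_zero,
      mul_one, mul_pow]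
    rw [Real.rpow_mul hx.le, Real.rpow_natCast]
    ring
  | succ n ih =>
    intro x hx
    -- The window stays away from 0, where the powers with negative exponent blow up, so one
    -- summable bound serves all its points.
    have hmem : Set.Ioo (x / 2) (2 * x) ∈ 𝓝 x := Ioo_mem_nhds (by linarith) (by linarith)
    have heq : iteratedDeriv n (fun y => Real.exp (c * y ^ α)) =ᶠ[𝓝 x]
        fun y => ∑' r, expRpowTerm α c n r y := by
      filter_upwards [lt_mem_nhds hx] with y hy using ih hy
    rw [iteratedDeriv_succ, heq.deriv_eq]
    have hx' : x ∈ Set.Ioo (x / 2) (2 * x) := mem_of_mem_nhds hmem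
    refine HasDerivAt.deriv (hasDerivAt_tsum_of_isPreconnected
      ((Real.summable_pow_div_factorial (|c| * Real.exp 1 * (2 * x) ^ α)).mul_left
        ((n + 1).factorial * Real.exp (n + 1 : ℕ) * ((x / 2) ^ (n + 1))⁻¹))
      isOpen_Ioo isPreconnected_Ioo (fun r y hy => ?_) (fun r y hy => ?_) hx'
      (summable_expRpowTerm hα c n hx) hx')
    · exact hasDerivAt_expRpowTerm α c n r ((half_pos hx).trans hy.1)
    · exact expRpowTerm_bound hα c (n + 1) r (half_pos hx) hy.1.le hy.2.le

lemma sfppTerm_eq {α lam : ℝ} (hα : 0 < α) (hlam : 0 < lam) (n : ℕ) (t : ℝ) (r : ℕ) :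
    sfppTerm α lam n t r = lam ^ n * expRpowTerm α (-t) n r lam := by
  rw [expRpowTerm, ← Gamma_add_one_div_Gamma_sub (by positivity), Real.rpow_sub hlam,
    Real.rpow_mul hlam.le, Real.rpow_natCast, Real.rpow_natCast, sfppTerm,
    show -(lam ^ α) * t = -t * lam ^ α by ring, mul_pow, div_mul_eq_div_div]
  field_simp

lemma summable_sfppTerm {α lam : ℝ} (hα : α ∈ Set.Ioo (0 : ℝ) 1) (hlam : 0 < lam) (n : ℕ)
    (t : ℝ) : Summable (sfppTerm α lam n t) := by
  simp_rw [funext (sfppTerm_eq hα.1 hlam n t)]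
  exact (summable_expRpowTerm hα _ _ hlam).mul_left _

lemma sfppProb_eq {α lam : ℝ} (hα : α ∈ Set.Ioo (0 : ℝ) 1) (hlam : 0 < lam) (n : ℕ) (t : ℝ) :
    sfppProb α lam n t = lam ^ n / n.factorial *
      iteratedDeriv n (fun x => Real.exp (-t * (-x) ^ α)) (-lam) := by
  rw [iteratedDeriv_comp_neg n (fun y => Real.exp (-t * y ^ α)), neg_neg,
    iteratedDeriv_exp_mul_rpow hα _ _ hlam, sfppProb, smul_eq_mul,
    tsum_congr (sfppTerm_eq hα.1 hlam n t), tsum_mul_left]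
  ring

/-! ### Taylor coefficients of an exponential semigroup -/

/-- The `n`-th Taylor coefficient of `x ↦ exp (t * g x)` at `a`. -/
noncomputable def expTaylor (g : ℝ → ℝ) (a : ℝ) (n : ℕ) (t : ℝ) : ℝ :=
  iteratedDeriv n (fun x => Real.exp (t * g x)) a / n.factorial

lemma iteratedDeriv_mul_div_factorial {f g : ℝ → ℝ} {a : ℝ} {n : ℕ} (hf : ContDiffAt ℝ n f a)
    (hg : ContDiffAt ℝ n g a) :
    iteratedDeriv n (fun x => f x * g x) a / n.factorial = ∑ k ∈ Finset.range (n + 1),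
      (iteratedDeriv k f a / k.factorial) *
        (iteratedDeriv (n - k) g a / (n - k).factorial) := by
  rw [iteratedDeriv_fun_mul hf hg, Finset.sum_div]
  refine Finset.sum_congr rfl fun k hk => ?_
  rw [Nat.cast_choose ℝ (Nat.lt_succ_iff.1 (Finset.mem_range.1 hk))]
  have : (n.factorial : ℝ) ≠ 0 := by positivity
  field_simp

lemma expTaylor_add {g : ℝ → ℝ} {a : ℝ} {n : ℕ} (hg : ContDiffAt ℝ n g a) (s t : ℝ) :
    expTaylor g a n (s + t) = ∑ k ∈ Finset.range (n + 1),
      expTaylor g a k s * expTaylor g a (n - k) t := by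
  simp only [expTaylor, add_mul, Real.exp_add]
  exact iteratedDeriv_mul_div_factorial (contDiffAt_const.mul hg).exp (contDiffAt_const.mul hg).exp

lemma expTaylor_at_zero (g : ℝ → ℝ) (a : ℝ) (n : ℕ) :
    expTaylor g a n 0 = if n = 0 then 1 else 0 := by
  simp only [expTaylor, zero_mul, Real.exp_zero, iteratedDeriv_const]
  split_ifs with h <;> simp [h]

/-- Leibniz's rule applied to (e^{tg})' = t g' e^{tg}. The explicit factor t turns differentiability
at t = 0 into mere continuity of the cofactor. -/
lemma expTaylor_succ {g : ℝ → ℝ} {a : ℝ} (hg : ContDiffAt ℝ (⊤ : ℕ∞) g a) (n : ℕ) (t : ℝ) :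
    expTaylor g a (n + 1) t = t * ((∑ k ∈ Finset.range (n + 1),
      ((k + 1) * (iteratedDeriv (k + 1) g a / (k + 1).factorial)) *
        expTaylor g a (n - k) t) / (n + 1)) := by
  have hg' : ∀ m : ℕ, ContDiffAt ℝ m g a := fun m => hg.of_le (by exact_mod_cast le_top)
  have hdg : ContDiffAt ℝ n (deriv g) a := by
    exact (hg' (n + 1)).derivWithin (by simp)
  have hd : deriv (fun x => Real.exp (t * g x)) =ᶠ[𝓝 a]
      fun x => t * (deriv g x * Real.exp (t * g x)) := by
    filter_upwards [(hg' 1).eventually (by simp)] with x hx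
    have h := (hx.differentiableAt (by simp)).hasDerivAt
    rw [((h.const_mul t).exp).deriv]
    ring
  rw [expTaylor, iteratedDeriv_succ', hd.iteratedDeriv_eq, Nat.factorial_succ,
    iteratedDeriv_const_mul_field]
  have h := iteratedDeriv_mul_div_factorial hdg (contDiffAt_const.mul (hg' n)).exp (g :=
    fun x => Real.exp (t * g x))
  have h2 : iteratedDeriv n (fun x => deriv g x * Real.exp (t * g x)) a / n.factorial =
      ∑ k ∈ Finset.range (n + 1), ((k + 1) * (iteratedDeriv (k + 1) g a / (k + 1).factorial)) *
        expTaylor g a (n - k) t := by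
    rw [h]
    refine Finset.sum_congr rfl fun k _ => ?_
    rw [← iteratedDeriv_succ', expTaylor, Nat.factorial_succ]
    push_cast
    field_simp
  rw [← h2]
  push_cast
  field_simp

lemma hasDerivAt_expTaylor_zero {g : ℝ → ℝ} {a : ℝ} (hg : ContDiffAt ℝ (⊤ : ℕ∞) g a) (n : ℕ) :
    HasDerivAt (expTaylor g a n) (iteratedDeriv n g a / n.factorial) 0 := by
  induction n using Nat.strong_induction_on with
  | _ n ih =>
  cases n with
  | zero =>
    have h := ((hasDerivAt_id (0 : ℝ)).mul_const (g a)).exp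
    have h2 : expTaylor g a 0 = fun t => Real.exp (t * g a) := by
      funext t
      simp [expTaylor]
    rw [h2]
    simpa using h
  | succ n =>
    have hF : ContinuousAt (fun t => (∑ k ∈ Finset.range (n + 1),
        ((k + 1) * (iteratedDeriv (k + 1) g a / (k + 1).factorial)) *
        expTaylor g a (n - k) t) / (n + 1)) 0 := by
      refine ContinuousAt.div_const (tendsto_finsetSum _ fun k _ => ?_) _
      exact continuousAt_const.mul (ih (n - k) (by omega)).continuousAt
    rw [funext (expTaylor_succ hg n)]
    rw [hasDerivAt_iff_tendsto_slope_zero]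
    have h0 : (∑ k ∈ Finset.range (n + 1),
        ((k + 1) * (iteratedDeriv (k + 1) g a / (k + 1).factorial)) *
        expTaylor g a (n - k) 0) / ((n : ℝ) + 1) =
          iteratedDeriv (n + 1) g a / (n + 1).factorial := by
      -- At t = 0 the exponential is the constant 1, so only its zeroth coefficient, at k = n,
      -- survives.
      rw [Finset.sum_eq_single n]
      · simp [expTaylor_at_zero]
        field_simp
      · intro k hk hkn
        have := Finset.mem_range.1 hk
        rw [expTaylor_at_zero, if_neg (by omega), mul_zero]
      · simp
    have h1 := hF.tendsto.mono_left (nhdsWithin_le_nhds (s := {0}ᶜ))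
    rw [h0] at h1
    refine h1.congr' ?_
    filter_upwards [self_mem_nhdsWithin] with t ht
    have ht : t ≠ 0 := ht
    simp [ht]

/-- The semigroup identity at s = (s - t) + t carries the derivative from 0 to t, so no interchange
of derivatives in x and t is needed. -/
lemma hasDerivAt_expTaylor {g : ℝ → ℝ} {a : ℝ} (hg : ContDiffAt ℝ (⊤ : ℕ∞) g a) (n : ℕ) (t : ℝ) :
    HasDerivAt (expTaylor g a n) (∑ k ∈ Finset.range (n + 1),
      (iteratedDeriv k g a / k.factorial) * expTaylor g a (n - k) t) t := by
  have h : HasDerivAt (fun s => ∑ k ∈ Finset.range (n + 1),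
      expTaylor g a k (s - t) * expTaylor g a (n - k) t) (∑ k ∈ Finset.range (n + 1),
      (iteratedDeriv k g a / k.factorial) * expTaylor g a (n - k) t) t := by
    refine HasDerivAt.fun_sum fun k _ => HasDerivAt.mul_const ?_ _
    have h0 := hasDerivAt_expTaylor_zero hg k
    rw [← sub_self t] at h0
    exact h0.comp_sub_const t t
  convert h using 1
  funext s
  rw [← expTaylor_add (hg.of_le (by exact_mod_cast le_top)), sub_add_cancel]

variable {Ω : Type*} [MeasurableSpace Ω]

/-! ### Evaluating a monotone field at an independent random point -/

lemma measureReal_mem_eq_integral {ι : Type*} [Countable ι] [MeasurableSpace ι]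
    [MeasurableSingletonClass ι] {P : Measure Ω} [IsProbabilityMeasure P] {K : Ω → ι}
    (hK : Measurable K) {A : ι → Set Ω} (hA : ∀ g, MeasurableSet (A g))
    (h : ∀ g, P (A g ∩ K ⁻¹' {g}) = P (A g) * P (K ⁻¹' {g})) :
    P.real {ω | ω ∈ A (K ω)} = ∫ ω, P.real (A (K ω)) ∂P := by
  have hset : {ω | ω ∈ A (K ω)} = ⋃ g, A g ∩ K ⁻¹' {g} := by
    ext ω; simp
  have hdisj : Pairwise (Function.onFun Disjoint fun g => A g ∩ K ⁻¹' {g}) := by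
    intro g g' hgg
    refine Set.disjoint_left.2 fun ω h1 h2 => hgg ?_
    exact h1.2.symm.trans h2.2
  have : IsProbabilityMeasure (P.map K) := Measure.isProbabilityMeasure_map hK.aemeasurable
  have hmeas : Measurable fun g => P.real (A g) := measurable_of_countable _
  have hint : Integrable (fun g => P.real (A g)) (P.map K) :=
    Integrable.of_bound hmeas.aestronglyMeasurable 1
      (ae_of_all _ fun g => by simp [abs_of_nonneg measureReal_nonneg, measureReal_le_one])
  rw [← integral_map hK.aemeasurable hmeas.aestronglyMeasurable, integral_countable hint, hset,
    measureReal_def, measure_iUnion hdisj fun g => (hA g).inter (hK (measurableSet_singleton g)),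
    ENNReal.tsum_toReal_eq fun g => measure_ne_top _ _]
  refine tsum_congr fun g => ?_
  rw [h g, ENNReal.toReal_mul, smul_eq_mul, mul_comm, measureReal_def, measureReal_def,
    Measure.map_apply hK (measurableSet_singleton g)]

lemma measurable_apply_of_countable {ι β : Type*} [Countable ι] [MeasurableSpace ι]
    [MeasurableSingletonClass ι] [MeasurableSpace β] {M : ι → Ω → β} {K : Ω → ι}
    (hM : ∀ g, Measurable (M g)) (hK : Measurable K) : Measurable fun ω => M (K ω) ω :=
  (measurable_from_prod_countable_right (f := fun q : ι × Ω => M q.1 q.2) hM).comp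
    (hK.prodMk measurable_id)

lemma IsMPP.measureReal_ne {d : ℕ} {lam : Fin d → ℝ} {N : (Fin d → ℝ≥0) → Ω → ℕ}
    {P : Measure Ω} [IsProbabilityMeasure P] (hN : IsMPP lam N P) {s t : Fin d → ℝ≥0}
    (hst : s ≤ t) :
    P.real {ω | N s ω ≠ N t ω} = 1 - Real.exp (-∑ i, lam i * (t - s) i) := by
  have h1 := (hN.stationary s t hst).measure_mem_eq (s := {0}ᶜ) (measurableSet_singleton 0).compl
  have h2 : {ω | N s ω ≠ N t ω} = (fun ω => (N t ω : ℝ) - (N s ω : ℝ)) ⁻¹' {0}ᶜ := by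
    ext ω
    simp [sub_eq_zero, eq_comm]
  have h3 : (fun ω => (N (t - s) ω : ℝ)) ⁻¹' {0}ᶜ = {ω | N (t - s) ω = 0}ᶜ := by
    ext ω
    simp
  have h4 := hN.poisson (t - s) 0
  rw [h2, measureReal_def, h1, h3, ← measureReal_def, probReal_compl_eq_one_sub, h4]
  · simp
  · exact hN.measurable _ (measurableSet_singleton 0)

/-! ### Dyadic approximation of the random point -/

/-- The lower corner of the dyadic cube of mesh `2⁻ᵏ` with index `m`. -/
noncomputable def gridPoint {d : ℕ} (k : ℕ) (m : Fin d → ℕ) : Fin d → ℝ≥0 :=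
  fun i => m i / 2 ^ k

/-- The index of the dyadic cube of mesh `2⁻ᵏ` that contains `x`. -/
noncomputable def gridIndex {d : ℕ} (k : ℕ) (x : Fin d → ℝ≥0) : Fin d → ℕ :=
  fun i => ⌊2 ^ k * x i⌋₊

lemma measurable_gridIndex {d : ℕ} (k : ℕ) : Measurable (gridIndex (d := d) k) :=
  measurable_pi_lambda _ fun i => Nat.measurable_floor.comp ((measurable_pi_apply i).const_mul _)

lemma gridPoint_gridIndex_le {d : ℕ} (k : ℕ) (x : Fin d → ℝ≥0) :
    gridPoint k (gridIndex k x) ≤ x := fun i => by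
  rw [gridPoint, gridIndex, div_le_iff₀' (by positivity)]
  exact Nat.floor_le (by positivity)

lemma le_gridPoint_gridIndex_add_one {d : ℕ} (k : ℕ) (x : Fin d → ℝ≥0) :
    x ≤ gridPoint k (gridIndex k x + 1) := fun i => by
  simp only [gridPoint, gridIndex, Pi.add_apply, Pi.one_apply]
  rw [le_div_iff₀' (by positivity)]
  simpa using (Nat.lt_floor_add_one (2 ^ k * x i)).le

lemma gridPoint_le_add_one {d : ℕ} (k : ℕ) (m : Fin d → ℕ) :
    gridPoint k m ≤ gridPoint k (m + 1) := fun i => by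
  simp only [gridPoint, Pi.add_apply, Pi.one_apply]
  gcongr
  simp

lemma gridPoint_add_one_sub {d : ℕ} (k : ℕ) (m : Fin d → ℕ) (i : Fin d) :
    (((gridPoint k (m + 1) - gridPoint k m : Fin d → ℝ≥0) i : ℝ≥0) : ℝ) = (1 / 2) ^ k := by
  rw [Pi.sub_apply, NNReal.coe_sub (gridPoint_le_add_one k m i)]
  simp only [gridPoint, Pi.add_apply, Pi.one_apply]
  push_cast
  rw [one_div, inv_pow]
  ring

lemma tendsto_gridPoint_gridIndex {d : ℕ} (x : Fin d → ℝ≥0) :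
    Tendsto (fun k => gridPoint k (gridIndex k x)) atTop (𝓝 x) := by
  refine tendsto_pi_nhds.2 fun i => ?_
  rw [← NNReal.tendsto_coe]
  have h0 : Tendsto (fun k : ℕ => (x i : ℝ) - (1 / 2) ^ k) atTop (𝓝 (x i)) := by
    simpa using tendsto_const_nhds.sub
      (tendsto_pow_atTop_nhds_zero_of_lt_one (r := (1 / 2 : ℝ)) (by norm_num) (by norm_num))
  refine tendsto_of_tendsto_of_tendsto_of_le_of_le h0 tendsto_const_nhds (fun k => ?_) fun k =>
    NNReal.coe_le_coe.2 (gridPoint_gridIndex_le k x i)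
  have h1 := gridPoint_add_one_sub k (gridIndex k x) i
  rw [Pi.sub_apply, NNReal.coe_sub (gridPoint_le_add_one k _ i)] at h1
  have h2 := NNReal.coe_le_coe.2 (le_gridPoint_gridIndex_add_one k x i)
  dsimp only
  linarith

section RandomPoint

variable {d : ℕ} {lam : Fin d → ℝ} {N : (Fin d → ℝ≥0) → Ω → ℕ} {P : Measure Ω}
  {X : Ω → Fin d → ℝ≥0}

/-- By stationarity the probability for a fixed cube depends only on its mesh, so averaging over the
random cube changes nothing. -/
lemma IsMPP.measureReal_gridPoint_ne [IsProbabilityMeasure P] (hN : IsMPP lam N P)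
    (hX : Measurable X) (hNX : IndepFun (fun ω u => N u ω) X P) (k : ℕ) :
    P.real {ω | N (gridPoint k (gridIndex k (X ω))) ω ≠
      N (gridPoint k (gridIndex k (X ω) + 1)) ω} = 1 - Real.exp (-((∑ i, lam i) * (1 / 2) ^ k)) := by
  have h := measureReal_mem_eq_integral ((measurable_gridIndex k).comp hX)
    (A := fun m => {ω | N (gridPoint k m) ω ≠ N (gridPoint k (m + 1)) ω}) (P := P)
    (fun m => (measurableSet_eq_fun (hN.measurable _) (hN.measurable _)).compl) (fun m => ?_)
  · rw [Function.comp_def] at h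
    refine h.trans ?_
    simp only [hN.measureReal_ne (gridPoint_le_add_one k _), gridPoint_add_one_sub,
      ← Finset.sum_mul, integral_const, probReal_univ, one_smul]
  · have h1 : MeasurableSet {f : (Fin d → ℝ≥0) → ℕ | f (gridPoint k m) ≠ f (gridPoint k (m + 1))} :=
      (measurableSet_eq_fun (measurable_pi_apply (gridPoint k m))
        (measurable_pi_apply (gridPoint k (m + 1)))).compl
    exact hNX.measure_inter_preimage_eq_mul _ _ h1
      (measurable_gridIndex k (measurableSet_singleton m))

lemma IsMPP.measureReal_gridPoint_eq [IsProbabilityMeasure P] (hN : IsMPP lam N P)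
    (hX : Measurable X) (hNX : IndepFun (fun ω u => N u ω) X P) (k n : ℕ) :
    P.real {ω | N (gridPoint k (gridIndex k (X ω))) ω = n} =
      ∫ ω, (∑ i, lam i * gridPoint k (gridIndex k (X ω)) i) ^ n / (n.factorial : ℝ) *
        Real.exp (-∑ i, lam i * gridPoint k (gridIndex k (X ω)) i) ∂P := by
  simp_rw [← hN.poisson]
  refine measureReal_mem_eq_integral ((measurable_gridIndex k).comp hX)
    (A := fun m => {ω | N (gridPoint k m) ω = n}) (P := P)
    (fun m => hN.measurable _ (measurableSet_singleton n)) (fun m => ?_)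
  have h1 : MeasurableSet {f : (Fin d → ℝ≥0) → ℕ | f (gridPoint k m) = n} :=
    measurableSet_eq_fun (measurable_pi_apply (gridPoint k m)) measurable_const
  exact hNX.measure_inter_preimage_eq_mul _ _ h1 (measurable_gridIndex k (measurableSet_singleton m))

lemma measurable_comp_gridPoint (hN : ∀ u, Measurable (N u)) (hX : Measurable X) (k : ℕ) :
    Measurable fun ω => N (gridPoint k (gridIndex k (X ω))) ω := by
  have h1 := (measurable_gridIndex k).comp hX
  have h2 := fun m : Fin d → ℕ => hN (gridPoint k m)
  exact measurable_apply_of_countable (ι := Fin d → ℕ) h2 h1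

/-- Monotonicity traps N at X between the two corner values. They differ with probability at most a
multiple of 2⁻ᵏ, because 1 - e^{-x} ≤ x, and Borel–Cantelli applies. -/
lemma IsMPP.ae_eventually_gridPoint_eq [IsProbabilityMeasure P] (hN : IsMPP lam N P)
    (hlam : ∀ i, 0 ≤ lam i) (hX : Measurable X) (hNX : IndepFun (fun ω u => N u ω) X P) :
    ∀ᵐ ω ∂P, ∀ᶠ k in atTop, N (gridPoint k (gridIndex k (X ω))) ω = N (X ω) ω := by
  have hle : ∀ k : ℕ, P {ω | N (gridPoint k (gridIndex k (X ω))) ω ≠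
      N (gridPoint k (gridIndex k (X ω) + 1)) ω} ≤
        ENNReal.ofReal ((∑ i, lam i) * (1 / 2) ^ k) := fun k => by
    rw [← ofReal_measureReal, hN.measureReal_gridPoint_ne hX hNX]
    refine ENNReal.ofReal_le_ofReal ?_
    linarith [Real.add_one_le_exp (-((∑ i, lam i) * (1 / 2) ^ k))]
  have hsum : (∑' k : ℕ, P {ω | N (gridPoint k (gridIndex k (X ω))) ω ≠
      N (gridPoint k (gridIndex k (X ω) + 1)) ω}) ≠ ⊤ := by
    refine ((ENNReal.tsum_le_tsum hle).trans_lt ?_).ne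
    have hs : Summable fun k : ℕ => (∑ i, lam i) * (1 / 2 : ℝ) ^ k :=
      summable_geometric_two.mul_left _
    have h0 := Finset.sum_nonneg fun i (_ : i ∈ Finset.univ) => hlam i
    rw [← ENNReal.ofReal_tsum_of_nonneg (fun k => by positivity) hs]
    exact ENNReal.ofReal_lt_top
  filter_upwards [ae_eventually_notMem hsum, hN.mono] with ω hω hmono
  filter_upwards [hω] with k hk
  simp only [ne_eq, not_not] at hk
  exact le_antisymm (hmono _ _ (gridPoint_gridIndex_le k _))
    ((hmono _ _ (le_gridPoint_gridIndex_add_one k _)).trans hk.ge)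

lemma IsMPP.aemeasurable_comp [IsProbabilityMeasure P] (hN : IsMPP lam N P)
    (hlam : ∀ i, 0 ≤ lam i) (hX : Measurable X) (hNX : IndepFun (fun ω u => N u ω) X P) :
    AEMeasurable (fun ω => N (X ω) ω) P := by
  refine aemeasurable_of_tendsto_metrizable_ae atTop
    (fun k => (measurable_comp_gridPoint hN.measurable hX k).aemeasurable) ?_
  filter_upwards [hN.ae_eventually_gridPoint_eq hlam hX hNX] with ω hω
  exact tendsto_const_nhds.congr' (hω.mono fun k hk => hk.symm)

lemma IsMPP.measureReal_comp_eq [IsProbabilityMeasure P] (hN : IsMPP lam N P)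
    (hlam : ∀ i, 0 ≤ lam i) (hX : Measurable X) (hNX : IndepFun (fun ω u => N u ω) X P) (n : ℕ) :
    P.real {ω | N (X ω) ω = n} =
      ∫ ω, (∑ i, lam i * X ω i) ^ n / (n.factorial : ℝ) * Real.exp (-∑ i, lam i * X ω i) ∂P := by
  have hae := hN.aemeasurable_comp hlam hX hNX
  have hlim1 : Tendsto (fun k => P.real {ω | N (gridPoint k (gridIndex k (X ω))) ω = n}) atTop
      (𝓝 (P.real {ω | N (X ω) ω = n})) := by
    -- The event itself may fail to be measurable, so a measurable version replaces it.
    have h1 : P.real {ω | N (X ω) ω = n} = P.real {ω | hae.mk _ ω = n} := by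
      refine measureReal_congr ?_
      filter_upwards [hae.ae_eq_mk] with ω hω
      change (_ = n) = (_ = n)
      rw [hω]
    rw [h1]
    refine (ENNReal.tendsto_toReal (measure_ne_top _ _)).comp
      (tendsto_measure_of_ae_tendsto_indicator_of_isFiniteMeasure atTop
        (hae.measurable_mk (measurableSet_singleton n))
        (fun k => measurable_comp_gridPoint hN.measurable hX k (measurableSet_singleton n)) ?_)
    filter_upwards [hae.ae_eq_mk, hN.ae_eventually_gridPoint_eq hlam hX hNX] with ω h2 h3
    filter_upwards [h3] with k hk
    rw [hk, h2]
  have hcont : Continuous fun x : Fin d → ℝ≥0 =>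
      (∑ i, lam i * (x i : ℝ)) ^ n / (n.factorial : ℝ) * Real.exp (-∑ i, lam i * (x i : ℝ)) := by
    fun_prop
  refine tendsto_nhds_unique hlim1 ?_
  simp_rw [hN.measureReal_gridPoint_eq hX hNX]
  refine tendsto_integral_of_dominated_convergence (fun _ => 1) (fun k => ?_)
    (integrable_const 1) (fun k => ae_of_all _ fun ω => ?_) (ae_of_all _ fun ω => ?_)
  · exact (hcont.measurable.comp ((measurable_of_countable (gridPoint k)).comp
      ((measurable_gridIndex k).comp hX))).aestronglyMeasurable
  -- The integrand is itself a Poisson probability, hence bounded by 1.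
  · rw [← hN.poisson, Real.norm_eq_abs, abs_of_nonneg measureReal_nonneg]
    exact measureReal_le_one
  · exact (hcont.tendsto _).comp (tendsto_gridPoint_gridIndex _)

end RandomPoint

/-! ### The fractional difference operator as a finite sum -/

lemma backShift_iterate (q : ℕ → ℝ) (r : ℕ) :
    ∀ n, (backShift^[r] q) n = if r ≤ n then q (n - r) else 0 := by
  induction r with
  | zero => simp
  | succ r ih =>
    intro n
    rw [Function.iterate_succ_apply']
    cases n with
    | zero => simp [backShift]
    | succ n => simp [backShift, ih]

lemma Gamma_div_factorial_mul_Gamma {x : ℝ} (hx : 0 ≤ x) (r : ℕ) :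
    Real.Gamma (x + 1) / ((r.factorial : ℝ) * Real.Gamma (x + 1 - r)) =
      (descPochhammer ℝ r).eval x / r.factorial := by
  rw [← Gamma_add_one_div_Gamma_sub hx, div_div, mul_comm]

lemma fracDiff_eq {α : ℝ} (hα : 0 ≤ α) (q : ℕ → ℝ) (n : ℕ) :
    fracDiff α q n = ∑ r ∈ Finset.range (n + 1), (-1) ^ r * Real.Gamma (α + 1) /
      ((r.factorial : ℝ) * Real.Gamma (α + 1 - r)) * q (n - r) := by
  rw [fracDiff, tsum_eq_sum (s := Finset.range (n + 1))]
  · refine Finset.sum_congr rfl fun r hr => ?_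
    rw [backShift_iterate, if_pos (Nat.lt_succ_iff.1 (Finset.mem_range.1 hr)), mul_div_assoc,
      Gamma_div_factorial_mul_Gamma hα, ringChoose_eq_descPochhammer_div]
  · intro r hr
    rw [backShift_iterate, if_neg, mul_zero]
    simpa [Nat.lt_succ_iff] using hr

/-! ### Moments through the moment generating function -/

/-- Since Z ≥ 0, the moment generating function is finite on the whole negative half-line, so -w is
an interior point and differentiation under the expectation is allowed there. -/
lemma integral_pow_mul_exp_neg {P : Measure Ω} [IsProbabilityMeasure P] {Z : Ω → ℝ}
    (hZ : Measurable Z) (hZ0 : ∀ ω, 0 ≤ Z ω) {F : ℝ → ℝ} (hF : ∀ x < 0, mgf Z P x = F x)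
    {w : ℝ} (hw : 0 < w) (n : ℕ) :
    ∫ ω, Z ω ^ n * Real.exp (-w * Z ω) ∂P = iteratedDeriv n F (-w) := by
  have hsub : Set.Iio (0 : ℝ) ⊆ integrableExpSet Z P := fun x hx => by
    refine Integrable.of_bound (hZ.const_mul x).exp.aestronglyMeasurable 1
      (ae_of_all _ fun ω => ?_)
    rw [Real.norm_eq_abs, Real.abs_exp, Real.exp_le_one_iff]
    exact mul_nonpos_of_nonpos_of_nonneg (le_of_lt hx) (hZ0 ω)
  have hint : -w ∈ interior (integrableExpSet Z P) :=
    interior_maximal hsub isOpen_Iio (neg_lt_zero.2 hw)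
  have heq : mgf Z P =ᶠ[𝓝 (-w)] F := by
    filter_upwards [gt_mem_nhds (neg_lt_zero.2 hw)] with x hx using hF x hx
  rw [← heq.iteratedDeriv_eq, iteratedDeriv_mgf hint]

lemma IsStableSubordinator.mgf_eq {α : ℝ} {S : ℝ≥0 → Ω → ℝ≥0} {P : Measure Ω}
    (hS : IsStableSubordinator α S P) (t : ℝ≥0) {x : ℝ} (hx : x < 0) :
    mgf (fun ω => (S t ω : ℝ)) P x = Real.exp (-(t : ℝ) * (-x) ^ α) := by
  rw [← hS.laplace t (-x) (neg_pos.2 hx), mgf, neg_neg]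

lemma IsStableSubordinator.integral_eq_sfppProb {α lam : ℝ} {S : ℝ≥0 → Ω → ℝ≥0} {P : Measure Ω}
    [IsProbabilityMeasure P] (hS : IsStableSubordinator α S P) (hα : α ∈ Set.Ioo (0 : ℝ) 1)
    (hlam : 0 < lam) (t : ℝ≥0) (n : ℕ) :
    ∫ ω, (lam * S t ω) ^ n / (n.factorial : ℝ) * Real.exp (-(lam * S t ω)) ∂P =
      sfppProb α lam n t := by
  rw [sfppProb_eq hα hlam, ← integral_pow_mul_exp_neg (hS.measurable t).coe_nnreal_real
    (fun ω => (S t ω).2) (fun x hx => hS.mgf_eq t hx) hlam, ← integral_const_mul]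
  refine integral_congr_ae (ae_of_all _ fun ω => ?_)
  simp only [mul_pow, neg_mul]
  ring

lemma integral_sum_pow_mul_exp_neg {d : ℕ} {P : Measure Ω} {Y : Fin d → Ω → ℝ}
    (hY : ∀ i, Measurable (Y i)) (hY0 : ∀ i ω, 0 ≤ Y i ω) (hind : iIndepFun Y P) (n : ℕ) :
    ∫ ω, (∑ i, Y i ω) ^ n / (n.factorial : ℝ) * Real.exp (-∑ i, Y i ω) ∂P =
      ∑ m ∈ Finset.Nat.antidiagonalTuple d n,
        ∏ i, ∫ ω, Y i ω ^ m i / ((m i).factorial : ℝ) * Real.exp (-Y i ω) ∂P := by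
  have := hind.isProbabilityMeasure
  have hmul : ∀ y : Fin d → ℝ, (∑ i, y i) ^ n / (n.factorial : ℝ) * Real.exp (-∑ i, y i) =
      ∑ m ∈ Finset.Nat.antidiagonalTuple d n,
        ∏ i, (y i ^ m i / ((m i).factorial : ℝ) * Real.exp (-y i)) := by
    intro y
    have hset : Finset.Nat.antidiagonalTuple d n = Finset.piAntidiag Finset.univ n := by
      ext m
      simp [Finset.Nat.mem_antidiagonalTuple]
    rw [Finset.sum_pow_eq_sum_piAntidiag, hset, Finset.sum_div, Finset.sum_mul]
    refine Finset.sum_congr rfl fun m hm => ?_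
    have hm' : ∑ i, m i = n := (Finset.mem_piAntidiag.1 hm).1
    rw [Finset.prod_mul_distrib, Finset.prod_div_distrib, ← Finset.sum_neg_distrib, Real.exp_sum]
    have hspec := Nat.multinomial_spec Finset.univ m
    rw [hm'] at hspec
    have hspec' : (∏ i, ((m i).factorial : ℝ)) * Nat.multinomial Finset.univ m = n.factorial := by
      exact_mod_cast hspec
    rw [← hspec']
    have h1 : (∏ i, ((m i).factorial : ℝ)) ≠ 0 :=
      Finset.prod_ne_zero_iff.2 fun i _ => by positivity
    have h2 : (Nat.multinomial Finset.univ m : ℝ) ≠ 0 := by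
      intro h
      rw [h, mul_zero] at hspec'
      exact (by positivity : (n.factorial : ℝ) ≠ 0) hspec'.symm
    field_simp
  simp_rw [hmul]
  have hint : ∀ m : Fin d → ℕ, Integrable
      (fun ω => ∏ i, (Y i ω ^ m i / ((m i).factorial : ℝ) * Real.exp (-Y i ω))) P := by
    intro m
    refine Integrable.of_bound (Measurable.aestronglyMeasurable (by fun_prop)) 1
      (ae_of_all _ fun ω => ?_)
    rw [Real.norm_eq_abs, Finset.abs_prod]
    refine Finset.prod_le_one (fun i _ => abs_nonneg _) fun i _ => ?_
    have h0 := hY0 i ω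
    -- Each factor is at most 1 because y^m / m! ≤ e^y.
    rw [abs_of_nonneg (by positivity), Real.exp_neg, ← div_eq_mul_inv,
      div_le_one (Real.exp_pos _)]
    exact Real.pow_div_factorial_le_exp _ h0 _
  rw [integral_finsetSum _ fun m _ => hint m]
  refine Finset.sum_congr rfl fun m _ => ?_
  exact hind.integral_fun_prod_comp
    (f := fun i y => y ^ m i / ((m i).factorial : ℝ) * Real.exp (-y))
    (fun i => (hY i).aemeasurable) fun i => Measurable.aestronglyMeasurable (by fun_prop)

/-! ### The Laplace exponent of the weighted sum of stable subordinators -/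

/-- The logarithm of the moment generating function of `∑ i, lam i * S i 1`, on `(-∞, 0)`. -/
noncomputable def logMgf {d : ℕ} (lam α : Fin d → ℝ) (x : ℝ) : ℝ :=
  ∑ j, -(lam j ^ α j) * (-x) ^ α j

lemma contDiffAt_logMgf_summand (c a : ℝ) {n : WithTop ℕ∞} :
    ContDiffAt ℝ n (fun x : ℝ => c * (-x) ^ a) (-1) :=
  contDiffAt_const.mul (contDiffAt_id.neg.rpow_const_of_ne (by simp))

lemma contDiffAt_logMgf {d : ℕ} (lam α : Fin d → ℝ) {n : WithTop ℕ∞} :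
    ContDiffAt ℝ n (logMgf lam α) (-1) :=
  ContDiffAt.sum fun j _ => contDiffAt_logMgf_summand (-(lam j ^ α j)) (α j)

/-- The reflection x ↦ -x produces (-1)^k; after division by k! the summands are the coefficients of
the binomial series of (1 - B)^α. -/
lemma iteratedDeriv_logMgf {d : ℕ} (lam α : Fin d → ℝ) (k : ℕ) :
    iteratedDeriv k (logMgf lam α) (-1) =
      ∑ j, -(lam j ^ α j) * ((-1) ^ k * (descPochhammer ℝ k).eval (α j)) := by
  have h : logMgf lam α = fun x => ∑ j, -(lam j ^ α j) * (-x) ^ α j := rfl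
  rw [h, iteratedDeriv_fun_sum fun j _ => contDiffAt_logMgf_summand _ _]
  refine Finset.sum_congr rfl fun j _ => ?_
  rw [iteratedDeriv_const_mul_field, iteratedDeriv_comp_neg k (fun y : ℝ => y ^ α j), neg_neg,
    iteratedDeriv_eq_iterate, Real.iter_deriv_rpow_const, Real.one_rpow, mul_one, smul_eq_mul]

lemma mgf_sum_stableSubordinator {d : ℕ} {lam α : Fin d → ℝ} (hlam : ∀ i, 0 < lam i)
    {S : Fin d → ℝ≥0 → Ω → ℝ≥0} {P : Measure Ω}
    (hS : ∀ i, IsStableSubordinator (α i) (S i) P) (t : ℝ≥0)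
    (hind : iIndepFun (fun i ω => lam i * (S i t ω : ℝ)) P) {x : ℝ} (hx : x < 0) :
    mgf (fun ω => ∑ i, lam i * (S i t ω : ℝ)) P x = Real.exp (t * logMgf lam α x) := by
  have h := hind.mgf_sum (t := x)
    (fun i => ((hS i).measurable t).coe_nnreal_real.const_mul (lam i)) Finset.univ
  rw [Finset.sum_fn] at h
  rw [h, logMgf, Finset.mul_sum, Real.exp_sum]
  refine Finset.prod_congr rfl fun i _ => ?_
  have h2 := (hS i).mgf_eq t (mul_neg_of_pos_of_neg (hlam i) hx)
  rw [show -(lam i * x) = lam i * -x by ring,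
    Real.mul_rpow (hlam i).le (neg_nonneg.2 hx.le)] at h2
  rw [mgf_const_mul, h2]
  congr 1
  ring

end MPP

theorem mainTheorem6 {Ω : Type*} [MeasurableSpace Ω] (P : Measure Ω) [IsProbabilityMeasure P]
    (d : ℕ) (hd : 1 ≤ d)
    (lam : Fin d → ℝ) (hlam : ∀ i, 0 < lam i)
    (α : Fin d → ℝ) (hα : ∀ i, α i ∈ Set.Ioo (0 : ℝ) 1)
    (N : (Fin d → ℝ≥0) → Ω → ℕ) (hN : MPP.IsMPP lam N P)
    (S : Fin d → ℝ≥0 → Ω → ℝ≥0) (hS : ∀ i, MPP.IsStableSubordinator (α i) (S i) P)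
    -- the subordinators are independent processes
    (hSindep : iIndepFun (fun (i : Fin d) (ω : Ω) (t : ℝ≥0) => S i t ω) P)
    -- the vector of subordinators is independent of the Poisson field
    (hNS : IndepFun (fun (ω : Ω) (u : Fin d → ℝ≥0) => N u ω)
      (fun (ω : Ω) (i : Fin d) (t : ℝ≥0) => S i t ω) P)
    (p : ℕ → ℝ≥0 → ℝ)
    (hp : ∀ n t, p n t = P.real {ω | MPP.timeChange N S t ω = n}) :
    -- the time-changed process consists of (almost everywhere measurable) random variables
    (∀ t, AEMeasurable (MPP.timeChange N S t) P) ∧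
    -- the series converge absolutely
    (∀ (i : Fin d) (n : ℕ) (t : ℝ≥0), Summable (MPP.sfppTerm (α i) (lam i) n t)) ∧
    -- the distribution, summed over all `(n₁, …, n_d)` with `n₁ + ⋯ + n_d = n`
    (∀ (n : ℕ) (t : ℝ≥0),
      p n t = ∑ m ∈ Finset.Nat.antidiagonalTuple d n,
        ∏ i, MPP.sfppProb (α i) (lam i) (m i) t) ∧
    -- the governing differential equations (one-sided derivative at `t = 0`)
    (∀ (n : ℕ) (t : ℝ≥0),
      HasDerivWithinAt (fun s : ℝ => p n s.toNNReal)
        (-∑ j, lam j ^ α j * ∑ r ∈ Finset.range (n + 1),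
          (-1) ^ r * Real.Gamma (α j + 1) /
            ((r.factorial : ℝ) * Real.Gamma (α j + 1 - r)) * p (n - r) t)
        (Set.Ici 0) (t : ℝ)) ∧
    -- the same right-hand side through the operators `(I - B) ^ α j`
    (∀ (n : ℕ) (t : ℝ≥0),
      HasDerivWithinAt (fun s : ℝ => p n s.toNNReal)
        (-∑ j, lam j ^ α j * MPP.fracDiff (α j) (fun k => p k t) n)
        (Set.Ici 0) (t : ℝ)) ∧
    -- the initial conditions
    p 0 0 = 1 ∧ (∀ n : ℕ, 1 ≤ n → p n 0 = 0) := by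
  have hX : ∀ t, Measurable fun ω (i : Fin d) => S i t ω := fun t =>
    measurable_pi_lambda _ fun i => (hS i).measurable t
  have hNX : ∀ t, IndepFun (fun ω u => N u ω) (fun ω (i : Fin d) => S i t ω) P := fun t => by
    have hm : Measurable fun (f : Fin d → ℝ≥0 → ℝ≥0) (i : Fin d) => f i t :=
      measurable_pi_lambda _ fun i => (measurable_pi_apply t).comp (measurable_pi_apply i)
    exact hNS.comp measurable_id hm
  have hY : ∀ t, iIndepFun (fun i ω => lam i * (S i t ω : ℝ)) P := fun t =>
    hSindep.comp (fun i f => lam i * (f t : ℝ)) fun i =>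
      (measurable_pi_apply t).coe_nnreal_real.const_mul _
  have hYm : ∀ t i, Measurable fun ω => lam i * (S i t ω : ℝ) := fun t i =>
    ((hS i).measurable t).coe_nnreal_real.const_mul _
  have hY0 : ∀ t i ω, 0 ≤ lam i * (S i t ω : ℝ) := fun t i ω =>
    mul_nonneg (hlam i).le (S i t ω).2
  have hpint : ∀ n t, p n t = ∫ ω, (∑ i, lam i * (S i t ω : ℝ)) ^ n / (n.factorial : ℝ) *
      Real.exp (-∑ i, lam i * (S i t ω : ℝ)) ∂P := fun n t =>
    (hp n t).trans (hN.measureReal_comp_eq (fun i => (hlam i).le) (hX t) (hNX t) n)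
  have hpT : ∀ n t, p n t = MPP.expTaylor (MPP.logMgf lam α) (-1) n t := fun n t => by
    rw [hpint, MPP.expTaylor, ← MPP.integral_pow_mul_exp_neg
      (Finset.measurable_fun_sum _ fun i _ => hYm t i)
      (fun ω => Finset.sum_nonneg fun i _ => hY0 t i ω)
      (fun x hx => MPP.mgf_sum_stableSubordinator hlam hS t (hY t) hx) one_pos, ← integral_div]
    refine integral_congr_ae (ae_of_all _ fun ω => ?_)
    simp only [neg_mul, one_mul]
    ring
  have hderiv : ∀ (n : ℕ) (t : ℝ≥0), HasDerivWithinAt (fun s : ℝ => p n s.toNNReal)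
      (-∑ j, lam j ^ α j * ∑ r ∈ Finset.range (n + 1), (-1) ^ r * Real.Gamma (α j + 1) /
        ((r.factorial : ℝ) * Real.Gamma (α j + 1 - r)) * p (n - r) t) (Set.Ici 0) (t : ℝ) := by
    intro n t
    have h := (MPP.hasDerivAt_expTaylor (MPP.contDiffAt_logMgf lam α) n t).hasDerivWithinAt
      (s := Set.Ici 0)
    -- `expTaylor` is differentiable on all of ℝ but agrees with p only for s ≥ 0, hence the
    -- derivative within `Set.Ici 0`.
    have hcongr : ∀ s ∈ Set.Ici (0 : ℝ),
        p n s.toNNReal = MPP.expTaylor (MPP.logMgf lam α) (-1) n s := fun s hs => by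
      rw [hpT, Real.coe_toNNReal s hs]
    refine (h.congr hcongr (hcongr _ t.2)).congr_deriv ?_
    simp_rw [MPP.iteratedDeriv_logMgf, Finset.mul_sum, Finset.sum_div, Finset.sum_mul]
    rw [Finset.sum_comm, ← Finset.sum_neg_distrib]
    refine Finset.sum_congr rfl fun j _ => ?_
    rw [← Finset.sum_neg_distrib]
    refine Finset.sum_congr rfl fun r _ => ?_
    rw [mul_div_assoc ((-1 : ℝ) ^ r), MPP.Gamma_div_factorial_mul_Gamma (hα j).1.le, hpT]
    ring
  refine ⟨fun t => hN.aemeasurable_comp (fun i => (hlam i).le) (hX t) (hNX t),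
    fun i n t => MPP.summable_sfppTerm (hα i) (hlam i) n t, fun n t => ?_, hderiv,
    fun n t => ?_, ?_, fun n hn => ?_⟩
  · rw [hpint, MPP.integral_sum_pow_mul_exp_neg (hYm t) (hY0 t) (hY t)]
    exact Finset.sum_congr rfl fun m _ => Finset.prod_congr rfl fun i _ =>
      (hS i).integral_eq_sfppProb (hα i) (hlam i) t (m i)
  · simp_rw [MPP.fracDiff_eq (hα _).1.le]
    exact hderiv n t
  · rw [hpT, NNReal.coe_zero, MPP.expTaylor_at_zero, if_pos rfl]
  · rw [hpT, NNReal.coe_zero, MPP.expTaylor_at_zero, if_neg (by omega)]
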